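/- Let $(A,\mathfrak m,k)$ be a commutative noetherian local ring. The grade $\operatorname{gr}\mathfrak c$ of an ideal $\mathfrak c\subset A$ is the length of a longest regular sequence contained in $\mathfrak c$, and $\operatorname{gr} A=\infty$. Consider complexes $$\mathbf F\;=\;0\to F_s\to\cdots\to F_i\xrightarrow{\,d_i\,}F_{i-1}\to\cdots\to F_0$$ of finitely generated free $A$-modules which are acyclic (exact at $F_i$ for all $i\ge 1$) and minimal (all differentials of $k\otimes_A\mathbf F$ are zero). Suppose that $A$ is stiff, i.e. for every such complex (of any length $s$), every $1\le i\le s$ and every choice of bases of $F_i$ and $F_{i-1}$, the ideal generated by the entries of any single column of the matrix of $d_i$ has grade at least $i$. Let $\mathbf F$ be such a complex of length $s$ over $A$ and let $1\le t\le i<s$. Then for every choice of bases of $F_i$ and $F_{i-1}$, with $X$ the matrix of $d_i$, and every choice of $t$ distinct columns of $X$, the ideal $\mathfrak c_{i,t}$ generated by all $t\times t$ minors of $X$ which occur in these $t$ columns satisfies $$\operatorname{gr}\mathfrak c_{i,t}\;\ge\; i-t+1 .$$ -/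

import Mathlib

universe u

/-- The grade of an ideal `I`: the supremum of the lengths of the regular sequences contained
in `I`, with the convention that the unit ideal has grade `∞`. -/
noncomputable def idealGrade {A : Type u} [CommRing A] (I : Ideal A) : ℕ∞ :=
  open Classical in
  if I = ⊤ then ⊤
  else ⨆ rs : {rs : List A // (∀ r ∈ rs, r ∈ I) ∧ RingTheory.Sequence.IsRegular A rs},
    (rs.1.length : ℕ∞)

/-- The ideal generated by the entries of the column `c` of the matrix `X`. -/
def columnIdeal {A : Type u} [CommRing A] {n m : ℕ} (X : Matrix (Fin n) (Fin m) A) (c : Fin m) :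
    Ideal A :=
  Ideal.span (Set.range fun r : Fin n => X r c)

/-- The ideal generated by all the `t × t` minors of the matrix `X` which occur in
the `t` distinct fixed columns `c 0, …, c (t - 1)`. -/
def columnMinorIdeal {A : Type u} [CommRing A] {n m t : ℕ} (X : Matrix (Fin n) (Fin m) A)
    (c : Fin t ↪ Fin m) : Ideal A :=
  Ideal.span (Set.range fun r : Fin t ↪ Fin n => (X.submatrix r c).det)

/-- `F` is a complex `0 → F_s → ⋯ → F_1 → F_0` of finite free modules over the local ring `A`
which is acyclic (exact in all positive degrees) and minimal (the complex `k ⊗ F` has null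
differentials, `k` being the residue field of `A`). -/
structure IsMinimalAcyclicFree {A : Type u} [CommRing A] [IsLocalRing A]
    (F : ChainComplex (ModuleCat.{u} A) ℕ) (s : ℕ) : Prop where
  free : ∀ i, Module.Free A (F.X i)
  finite : ∀ i, Module.Finite A (F.X i)
  length_le : ∀ i, s < i → Subsingleton (F.X i)
  acyclic : ∀ i, 1 ≤ i → F.ExactAt i
  minimal : ∀ i, (F.d (i + 1) i).hom.baseChange (IsLocalRing.ResidueField A) = 0

/-- The complex `F` of length `s` is stiff: for all `1 ≤ i ≤ s`, every column ideal of every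
matrix describing `d_i : F_i → F_{i-1}`, for any choice of bases, has grade at least `i`. -/
def IsStiffComplex {A : Type u} [CommRing A] (F : ChainComplex (ModuleCat.{u} A) ℕ) (s : ℕ) :
    Prop :=
  ∀ i : ℕ, 1 ≤ i → i ≤ s → ∀ (m n : ℕ) (b : Module.Basis (Fin m) A (F.X i))
    (b' : Module.Basis (Fin n) A (F.X (i - 1))) (c : Fin m),
    (i : ℕ∞) ≤ idealGrade (columnIdeal (LinearMap.toMatrix b b' (F.d i (i - 1)).hom) c)

/-- A local ring is stiff if every minimal acyclic complex of finite free modules of finite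
length over it is stiff. -/
def IsStiffRing (A : Type u) [CommRing A] [IsLocalRing A] : Prop :=
  ∀ (s : ℕ) (F : ChainComplex (ModuleCat.{u} A) ℕ),
    IsMinimalAcyclicFree F s → IsStiffComplex F s

/-! Let `Z` be the cokernel of `F_{i+1} → F_i`. If the grade were at most `i - t`, prime avoidance
would give a prime `p` containing the minors with `g = depth A_p ≤ i - t`. By Auslander–Buchsbaum,
`Z_p` is free and is a direct summand of `F_{i-1}` at `p`. It therefore suffices that the `t` chosen
basis vectors of `F_i` become part of a basis of `Z_p` (`IsStiffRing.hasDualFamilyAt`): the `t`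
columns then have a left inverse over `A_p`, so some minor lies outside `p`.

The vectors are treated one at a time. Dividing `Z` by the set `S` of those already treated leaves a
module resolved by the same complex with the coordinates in `S` deleted from `F_i`, and it still
behaves like an `(i - |S|)`-th syzygy. Such a module embeds in a free module with a cokernel of the
same kind, of order one less (`IsSyzygyLike.exists_embedding`), so its resolution can be prolonged
to the right `i - |S|` times. Stiffness of the prolonged complex bounds the grade of the order ideal
of the next vector below by `i - |S| > g`, so some linear form takes a value outside `p` on it.

Nothing is localised: statements at `p` hold up to a multiplier outside `p`. -/

open CategoryTheory Abelian RingTheory.Sequence Pointwise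

/-! ### Depth through vanishing of Ext -/

section Depth

variable {A : Type u} [CommRing A]

/-- The groups `Ext^j(A/J, M)` vanish for all `j < k`. Over a noetherian ring this expresses that
the `J`-depth of the finite module `M` is at least `k`. -/
def DepthGE (J : Ideal A) (k : ℕ) (M : Type u) [AddCommGroup M] [Module A M] : Prop :=
  ∀ j < k, Subsingleton (Ext (ModuleCat.of A (A ⧸ J)) (ModuleCat.of A M) j)

variable {M N L : Type u} [AddCommGroup M] [Module A M] [AddCommGroup N] [Module A N]
  [AddCommGroup L] [Module A L] {J : Ideal A} {k : ℕ}

theorem DepthGE.mono (h : DepthGE J k M) {l : ℕ} (hl : l ≤ k) : DepthGE J l M :=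
  fun j hj => h j (hj.trans_le hl)

theorem DepthGE.of_equiv (e : M ≃ₗ[A] N) (h : DepthGE J k M) : DepthGE J k N := fun j hj => by
  have := h j hj
  refine ⟨fun x y => ?_⟩
  have key : ∀ z : Ext (ModuleCat.of A (A ⧸ J)) (ModuleCat.of A N) j, z = 0 := fun z => by
    have h1 : z = (z.comp (Ext.mk₀ (e.toModuleIso).inv) (add_zero j)).comp
        (Ext.mk₀ (e.toModuleIso).hom) (add_zero j) := by
      have h2 : (e.toModuleIso).inv ≫ (e.toModuleIso).hom = 𝟙 (ModuleCat.of A N) :=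
        (e.toModuleIso).inv_hom_id
      rw [Ext.comp_assoc_of_second_deg_zero, Ext.mk₀_comp_mk₀, h2, Ext.comp_mk₀_id]
    rw [h1, Subsingleton.elim (z.comp (Ext.mk₀ (e.toModuleIso).inv) (add_zero j)) 0,
      Ext.zero_comp]
  rw [key x, key y]

/-- The short exact sequence in `ModuleCat A` attached to a pair of linear maps. -/
theorem exists_shortExact (f : M →ₗ[A] N) (g : N →ₗ[A] L) (hf : Function.Injective f)
    (hfg : Function.Exact f g) (hg : Function.Surjective g) :
    (ModuleCat.shortComplexOfCompEqZero f g hfg.linearMap_comp_eq_zero).ShortExact where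
  exact := ModuleCat.shortComplex_exact _ hfg
  mono_f := (ModuleCat.mono_iff_injective _).mpr hf
  epi_g := (ModuleCat.epi_iff_surjective _).mpr hg

/-- This and the next two results are the depth lemma, read off the long exact Ext sequence. -/
theorem DepthGE.right (f : M →ₗ[A] N) (g : N →ₗ[A] L) (hf : Function.Injective f)
    (hfg : Function.Exact f g) (hg : Function.Surjective g)
    (hM : DepthGE J (k + 1) M) (hN : DepthGE J k N) : DepthGE J k L := fun j hj => by
  have h1 := hM (j + 1) (by omega)
  have h2 := hN j hj
  have hS := exists_shortExact f g hf hfg hg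
  refine subsingleton_of_forall_eq 0 fun x => ?_
  obtain ⟨y, rfl⟩ := Ext.covariant_sequence_exact₃ (ModuleCat.of A (A ⧸ J)) hS x rfl
    (h1.elim _ _)
  rw [h2.elim y 0, Ext.zero_comp]

theorem DepthGE.middle (f : M →ₗ[A] N) (g : N →ₗ[A] L) (hf : Function.Injective f)
    (hfg : Function.Exact f g) (hg : Function.Surjective g)
    (hM : DepthGE J k M) (hL : DepthGE J k L) : DepthGE J k N := fun j hj => by
  have h1 := hM j hj
  have h2 := hL j hj
  have hS := exists_shortExact f g hf hfg hg
  refine subsingleton_of_forall_eq 0 fun x => ?_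
  obtain ⟨y, rfl⟩ := Ext.covariant_sequence_exact₂ (ModuleCat.of A (A ⧸ J)) hS x
    (h2.elim _ _)
  rw [h1.elim y 0, Ext.zero_comp]

theorem DepthGE.left (f : M →ₗ[A] N) (g : N →ₗ[A] L) (hf : Function.Injective f)
    (hfg : Function.Exact f g) (hg : Function.Surjective g)
    (hN : DepthGE J (k + 1) N) (hL : DepthGE J k L) : DepthGE J (k + 1) M := fun j hj => by
  have h1 := hN j hj
  have hS := exists_shortExact f g hf hfg hg
  refine subsingleton_of_forall_eq 0 fun x => ?_
  obtain _ | j := j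
  · have := hS.mono_f
    exact Ext.postcomp_mk₀_injective_of_mono (ModuleCat.of A (A ⧸ J)) (ModuleCat.ofHom f)
      (h1.elim _ _)
  · have h2 := hL j (by omega)
    obtain ⟨y, rfl⟩ := Ext.covariant_sequence_exact₁ (ModuleCat.of A (A ⧸ J)) hS x
      (h1.elim _ _) rfl
    rw [h2.elim y 0, Ext.zero_comp]

theorem DepthGE.of_subsingleton [Subsingleton M] : DepthGE J k M := fun j _ => by
  have hM : Limits.IsZero (ModuleCat.of A M) := ModuleCat.isZero_of_subsingleton _
  refine subsingleton_of_forall_eq 0 fun x => ?_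
  rw [← Ext.comp_mk₀_id x, hM.eq_of_src (𝟙 _) 0, Ext.mk₀_zero, Ext.comp_zero]

theorem DepthGE.pi (h : DepthGE J k A) : ∀ n : ℕ, DepthGE J k (Fin n → A)
  | 0 => .of_subsingleton
  | n + 1 => by
    refine DepthGE.middle (LinearMap.single A (fun _ : Fin (n + 1) => A) 0)
      (LinearMap.funLeft A A Fin.succ) (fun x y h => by simpa using congrFun h 0) (fun x => ⟨?_, ?_⟩) ?_ h
      (DepthGE.pi h n)
    · intro hx
      refine ⟨x 0, funext fun i => ?_⟩
      refine Fin.cases (by simp) (fun i => ?_) i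
      have := congrFun hx i
      simp only [LinearMap.funLeft_apply, Pi.zero_apply] at this
      simp [this]
    · rintro ⟨y, rfl⟩
      ext i
      simp [LinearMap.funLeft_apply]
    · exact LinearMap.funLeft_surjective_of_injective _ _ _ (Fin.succ_injective n)

theorem DepthGE.of_free [Module.Free A M] [Module.Finite A M] (h : DepthGE J k A) :
    DepthGE J k M := by
  cases subsingleton_or_nontrivial A
  · have := Module.subsingleton A M
    exact .of_subsingleton
  exact (DepthGE.pi h _).of_equiv (Module.finBasis A M).equivFun.symm

theorem DepthGE.eq_zero (h : DepthGE J (k + 1) M) {m : M} (hm : ∀ x ∈ J, x • m = 0) : m = 0 := by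
  have : Subsingleton (ModuleCat.of A (A ⧸ J) ⟶ ModuleCat.of A M) :=
    Ext.addEquiv₀.subsingleton_congr.mp (h 0 (by omega))
  have : Subsingleton ((A ⧸ J) →ₗ[A] M) :=
    (ModuleCat.homAddEquiv (M := ModuleCat.of A (A ⧸ J)) (N := ModuleCat.of A M)).symm.subsingleton
  have h1 := this.elim (Submodule.liftQ J (LinearMap.toSpanSingleton A M m)
    fun x hx => by simpa using hm x hx) 0
  have h2 := LinearMap.congr_fun h1 (Submodule.Quotient.mk 1)
  rw [Submodule.liftQ_apply] at h2
  simpa using h2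

theorem DepthGE.quotSMulTop {r : A} (hr : IsSMulRegular M r) (h : DepthGE J (k + 1) M) :
    DepthGE J k (QuotSMulTop r M) :=
  DepthGE.right (LinearMap.lsmul A M r) (r • (⊤ : Submodule A M)).mkQ hr
    (LinearMap.exact_lsmul_mkQ_smul_top M r) (Submodule.mkQ_surjective _) h (h.mono (by omega))

theorem DepthGE.quotient {rs : List A} (hrs : IsWeaklyRegular M rs)
    (h : DepthGE J (k + rs.length) M) :
    DepthGE J k (M ⧸ (Ideal.ofList rs • ⊤ : Submodule A M)) := by
  induction rs generalizing M with
  | nil =>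
    exact DepthGE.of_equiv (Submodule.quotEquivOfEqBot _ (by simp)).symm h
  | cons r rs ih =>
    rw [isWeaklyRegular_cons_iff] at hrs
    exact (ih hrs.2 (DepthGE.quotSMulTop hrs.1 (h.mono (by simp [add_assoc])))).of_equiv
      (Submodule.quotOfListConsSMulTopEquivQuotSMulTopInner M r rs).symm

end Depth

/-! ### Grade and primes of given depth -/

section Grade

variable {A : Type u} [CommRing A]

/-- A prime ideal `p` which is associated to `A / (a₁, …, a_g)` for some weakly regular
sequence `a₁, …, a_g`; that is to say, `depth A_p = g`. -/
def IsDepthPrime (g : ℕ) (p : Ideal A) : Prop :=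
  p.IsPrime ∧ ∃ rs : List A, IsWeaklyRegular A rs ∧ rs.length = g ∧
    ∃ y ∉ Ideal.ofList rs, ∀ x, x ∈ p ↔ x * y ∈ Ideal.ofList rs

/-- Dividing by the `g < k` elements of `rs` leaves positive `J`-depth, so the nonzero class of `y`,
killed by `p`, cannot be killed by `J`. -/
theorem IsDepthPrime.not_le {g k : ℕ} {p J : Ideal A} (hp : IsDepthPrime g p) (hg : g < k)
    (hJ : DepthGE J k A) : ¬ J ≤ p := by
  obtain ⟨-, rs, hrs, rfl, y, hy, h⟩ := hp
  intro hle
  have h1 := DepthGE.quotient (k := (k - rs.length - 1) + 1) hrs (hJ.mono (by omega))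
  apply hy
  have h2 := h1.eq_zero (m := Submodule.Quotient.mk y) fun x hx => by
    rw [← Submodule.Quotient.mk_smul, Submodule.Quotient.mk_eq_zero]
    simpa using (h x).1 (hle hx)
  rw [Submodule.Quotient.mk_eq_zero] at h2
  simpa using h2

theorem natCast_le_idealGrade_iff {J : Ideal A} {k : ℕ} :
    (k : ℕ∞) ≤ idealGrade J ↔ J = ⊤ ∨ ∃ rs : List A, k ≤ rs.length ∧ (∀ r ∈ rs, r ∈ J) ∧
      IsRegular A rs := by
  classical
  unfold idealGrade
  split_ifs with h
  · simp [h]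
  · simp only [h, false_or]
    constructor
    · intro hk
      by_contra! hcon
      obtain _ | k := k
      · have : Nontrivial A := by
          by_contra hn
          rw [not_nontrivial_iff_subsingleton] at hn
          exact h (Subsingleton.elim _ _)
        exact hcon [] (by simp) (by simp) (IsRegular.nil A A)
      · have : (⨆ rs : {rs : List A // (∀ r ∈ rs, r ∈ J) ∧ IsRegular A rs},
            (rs.1.length : ℕ∞)) ≤ k := iSup_le fun ⟨rs, h1, h2⟩ => by
          by_contra! hlt
          exact hcon rs (by exact_mod_cast hlt) h1 h2
        have := hk.trans this
        norm_cast at this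
        omega
    · rintro ⟨rs, h1, h2, h3⟩
      exact le_trans (by exact_mod_cast h1) (le_iSup
        (fun rs : {rs : List A // (∀ r ∈ rs, r ∈ J) ∧ IsRegular A rs} => (rs.1.length : ℕ∞))
        ⟨rs, h2, h3⟩)

variable [IsNoetherianRing A]

theorem depthGE_of_le_idealGrade {J : Ideal A} {k : ℕ} (h : (k : ℕ∞) ≤ idealGrade J) :
    DepthGE J k A := by
  by_cases hJ : J = ⊤
  · intro j _
    have : Subsingleton (A ⧸ J) := Submodule.Quotient.subsingleton_iff.2 hJ
    have hM : Limits.IsZero (ModuleCat.of A (A ⧸ J)) := ModuleCat.isZero_of_subsingleton _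
    refine subsingleton_of_forall_eq 0 fun x => ?_
    rw [← Ext.mk₀_id_comp x, hM.eq_of_src (𝟙 _) 0, Ext.mk₀_zero, Ext.zero_comp]
  · obtain ⟨rs, h1, h2, h3⟩ := (natCast_le_idealGrade_iff.1 h).resolve_left hJ
    intro j hj
    refine ModuleCat.subsingleton_ext_of_exists_isRegular J (ModuleCat.of A (A ⧸ J)) ?_
      (ModuleCat.of A A) ?_ rs h2 h3 j (by omega)
    · change Module.support A (A ⧸ J) ⊆ _
      rw [Module.support_eq_zeroLocus, Ideal.annihilator_quotient]
    · simpa [lt_top_iff_ne_top] using hJ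

/-- A regular sequence in `J` is extended while possible. When it cannot be, `J` consists of zero
divisors modulo the sequence, and prime avoidance puts it in an associated prime. -/
theorem exists_isDepthPrime_of_lt {J : Ideal A} (hJ : J ≠ ⊤) (k : ℕ) :
    (∃ g < k, ∃ p, IsDepthPrime g p ∧ J ≤ p) ∨
      ∃ rs : List A, rs.length = k ∧ (∀ r ∈ rs, r ∈ J) ∧ IsRegular A rs := by
  induction k with
  | zero =>
    have : Nontrivial A := by
      by_contra hn
      rw [not_nontrivial_iff_subsingleton] at hn
      exact hJ (Subsingleton.elim _ _)
    exact .inr ⟨[], by simp, by simp, IsRegular.nil A A⟩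
  | succ k ih =>
    obtain ⟨g, hg, h⟩ | ⟨rs, h1, h2, h3⟩ := ih
    · exact .inl ⟨g, by omega, h⟩
    set Q := A ⧸ (Ideal.ofList rs • ⊤ : Submodule A A) with hQ
    by_cases hx : ∃ x ∈ J, IsSMulRegular Q x
    · obtain ⟨x, hx, hreg⟩ := hx
      refine .inr ⟨rs ++ [x], by simp [h1], ?_, ⟨?_, ?_⟩⟩
      · simpa [or_imp, forall_and] using ⟨h2, hx⟩
      · rw [isWeaklyRegular_append_iff]
        exact ⟨h3.1, (isWeaklyRegular_singleton_iff _ _).2 hreg⟩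
      · intro htop
        apply hJ
        rw [eq_top_iff]
        have : Ideal.ofList (rs ++ [x]) ≤ J := by
          rw [Ideal.ofList, Ideal.span_le]
          intro r hr
          simp only [List.mem_append, List.mem_singleton, Set.mem_ofPred_eq] at hr
          exact hr.elim (h2 r) (fun h => h ▸ hx)
        refine le_trans ?_ this
        simpa using htop.le
    · left
      obtain ⟨p, hp, hJp⟩ : ∃ p ∈ associatedPrimes A Q, J ≤ p := by
        apply (Ideal.subset_union_prime_finite (associatedPrimes.finite A Q) ⊥ ⊥ _).mp
        · rw [biUnion_associatedPrimes_eq_compl_regular A Q]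
          exact fun r hr hreg => hx ⟨r, hr, hreg⟩
        · exact fun I hin _ _ => IsAssociatedPrime.isPrime hin
      rw [AssociatedPrimes.mem_iff, isAssociatedPrime_iff] at hp
      obtain ⟨hp, x, rfl⟩ := hp
      obtain ⟨y, rfl⟩ := Submodule.Quotient.mk_surjective _ x
      have key : ∀ z, z ∈ Submodule.colon (⊥ : Submodule A Q) {Submodule.Quotient.mk y} ↔
          z * y ∈ Ideal.ofList rs := fun z => by
        rw [Submodule.mem_colon_singleton, ← Submodule.Quotient.mk_smul, Submodule.mem_bot,
          Submodule.Quotient.mk_eq_zero]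
        simp
      refine ⟨k, by omega, _, ⟨hp, rs, h3.1, h1, y, fun hy => hp.ne_top ?_, key⟩, hJp⟩
      rw [Ideal.eq_top_iff_one, key]
      simpa using hy

theorem exists_isDepthPrime_of_not_le_idealGrade {J : Ideal A} {k : ℕ}
    (h : ¬ (k : ℕ∞) ≤ idealGrade J) : ∃ g < k, ∃ p, IsDepthPrime g p ∧ J ≤ p := by
  rw [natCast_le_idealGrade_iff] at h
  push Not at h
  refine (exists_isDepthPrime_of_lt h.1 k).resolve_right ?_
  rintro ⟨rs, h1, h2, h3⟩
  exact h.2 rs h1.ge h2 h3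

end Grade

/-! ### Direct summands of free modules at a prime -/

section FreeModules

variable {A : Type u} [CommRing A]

theorem LinearMap.apply_mem_of_mem_smul_top {F : Type*} [AddCommGroup F] [Module A F] {I : Ideal A}
    {v : F} (hv : v ∈ I • (⊤ : Submodule A F)) (π : F →ₗ[A] A) : π v ∈ I := by
  refine Submodule.smul_induction_on hv (fun r hr x _ => ?_) fun x y hx hy => ?_
  · rw [map_smul, smul_eq_mul]
    exact I.mul_mem_right _ hr
  · rw [map_add]
    exact I.add_mem hx hy

theorem Module.Basis.mem_smul_top {F ι : Type*} [AddCommGroup F] [Module A F]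
    (b : Module.Basis ι A F) {I : Ideal A} {v : F} (h : ∀ i, b.repr v i ∈ I) :
    v ∈ I • (⊤ : Submodule A F) := by
  rw [← b.linearCombination_repr v, Finsupp.linearCombination_apply]
  exact Submodule.sum_mem _ fun i _ => Submodule.smul_mem_smul (h i) trivial

theorem Module.Free.mem_smul_top_iff {F : Type*} [AddCommGroup F] [Module A F] [Module.Free A F]
    {I : Ideal A} {v : F} :
    v ∈ I • (⊤ : Submodule A F) ↔ ∀ π : F →ₗ[A] A, π v ∈ I :=
  ⟨LinearMap.apply_mem_of_mem_smul_top, fun h =>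
    (Module.Free.chooseBasis A F).mem_smul_top fun i => h ((Module.Free.chooseBasis A F).coord i)⟩

/-- Cayley–Hamilton: multiplication by `s` satisfies a monic polynomial with lower coefficients in
`p`. Its value at `s` is a power of `s` modulo `p`, and it kills `B`. -/
theorem exists_notMem_smul_eq_zero {B : Type*} [AddCommGroup B] [Module A B] [Module.Finite A B]
    {p : Ideal A} (hp : p.IsPrime) {s : A} (hs : s ∉ p)
    (h : ∀ v : B, s • v ∈ p • (⊤ : Submodule A B)) : ∃ t ∉ p, ∀ v : B, t • v = 0 := by
  obtain ⟨P, hP, -, hc, h0⟩ :=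
    LinearMap.exists_monic_and_natDegree_eq_and_coeff_mem_pow_and_aeval_eq_zero (R := A) (M := B)
      (algebraMap A (Module.End A B) s) p (by rintro _ ⟨v, rfl⟩; exact h v)
  refine ⟨P.eval s, fun hmem => ?_, fun v => ?_⟩
  · rw [Polynomial.eval_eq_sum_range, Finset.sum_range_succ, hP.coeff_natDegree, one_mul] at hmem
    refine hs (hp.mem_of_pow_mem P.natDegree ((Ideal.add_mem_iff_right p ?_).1 hmem))
    refine Ideal.sum_mem _ fun i hi => Ideal.mul_mem_right _ _ ?_
    exact Ideal.pow_le_self (by rw [Finset.mem_range] at hi; omega) (hc i)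
  · rw [Polynomial.aeval_algebraMap_apply] at h0
    simpa using LinearMap.congr_fun h0 v

/-- A criterion for a finitely generated submodule `B` of a free module to become a direct summand
after localisation at the prime `p`. -/
theorem exists_retraction_at {F : Type*} [AddCommGroup F] [Module A F] [Module.Free A F]
    {p : Ideal A} (hp : p.IsPrime) (n : ℕ) : ∀ (b : Fin n → F) {s : A}, s ∉ p →
    (∀ v ∈ Submodule.span A (Set.range b), v ∈ p • (⊤ : Submodule A F) →
      s • v ∈ p • Submodule.span A (Set.range b)) →
    ∃ ψ : F →ₗ[A] F, ∃ t ∉ p, (∀ x, ψ x ∈ Submodule.span A (Set.range b)) ∧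
      ∀ v ∈ Submodule.span A (Set.range b), ψ v = t • v := by
  induction n with
  | zero =>
    intro b s hs h
    refine ⟨0, s, hs, by simp, ?_⟩
    intro v hv
    rw [Set.range_eq_empty, Submodule.span_empty, Submodule.mem_bot] at hv
    simp [hv]
  | succ n ih =>
    intro b s hs h
    set B := Submodule.span A (Set.range b) with hB
    have hbB : ∀ i, b i ∈ B := fun i => Submodule.subset_span ⟨i, rfl⟩
    -- If all generators lie in `pF`, the hypothesis reads `sB ⊆ pB` and `B` vanishes at `p`.
    -- Otherwise a generator with a coordinate outside `p` is split off.
    by_cases hb : ∀ i, b i ∈ p • (⊤ : Submodule A F)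
    · have hle : B ≤ p • (⊤ : Submodule A F) := by
        rw [hB, Submodule.span_le]
        rintro _ ⟨i, rfl⟩
        exact hb i
      have : Module.Finite A B := Module.Finite.iff_fg.2 (Submodule.fg_span (Set.finite_range b))
      obtain ⟨t, ht, h0⟩ := exists_notMem_smul_eq_zero (B := B) hp hs fun v => by
        rw [Submodule.mem_smul_top_iff]
        exact h v v.2 (hle v.2)
      refine ⟨0, t, ht, by simp, fun v hv => ?_⟩
      simpa using (congrArg Subtype.val (h0 ⟨v, hv⟩)).symm
    · push Not at hb
      obtain ⟨k, hk⟩ := hb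
      rw [Module.Free.mem_smul_top_iff] at hk
      push Not at hk
      obtain ⟨π, hu⟩ := hk
      -- Up to the factor `π (b k)`, this is the projection onto `ker π` along `b k`. It maps `B`
      -- into itself and removes one generator.
      let τ : F →ₗ[A] F := π (b k) • LinearMap.id - π.smulRight (b k)
      have hτ : ∀ v, τ v = π (b k) • v - π v • b k := fun v => by simp [τ]
      have hτk : τ (b k) = 0 := by simp [hτ]
      have hB' : Submodule.span A (Set.range fun j => τ (b (k.succAbove j))) = B.map τ := by
        apply le_antisymm
        · rw [Submodule.span_le]
          rintro _ ⟨j, rfl⟩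
          exact Submodule.mem_map_of_mem (hbB _)
        · rw [hB, Submodule.map_span, Submodule.span_le]
          rintro _ ⟨_, ⟨i, rfl⟩, rfl⟩
          obtain rfl | ⟨j, rfl⟩ := Fin.eq_self_or_eq_succAbove k i
          · rw [hτk]
            exact zero_mem _
          · exact Submodule.subset_span ⟨j, rfl⟩
      have hle : B.map τ ≤ B := by
        rintro _ ⟨v, hv, rfl⟩
        rw [hτ]
        exact B.sub_mem (B.smul_mem _ hv) (B.smul_mem _ (hbB k))
      obtain ⟨ψ, t, ht, h1, h2⟩ := ih (fun j => τ (b (k.succAbove j))) (s := π (b k) * s)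
        (fun hmem => (hp.mem_or_mem hmem).elim hu hs) (by
          rw [hB']
          intro v hv hvp
          have h3 := Submodule.mem_map_of_mem (f := τ) (h v (hle hv) hvp)
          rw [Submodule.map_smul'', map_smul] at h3
          have h4 : π v = 0 := by
            obtain ⟨w, -, rfl⟩ := hv
            simp [hτ, mul_comm]
          rwa [hτ, h4, zero_smul, sub_zero, smul_comm, smul_smul] at h3)
      rw [hB'] at h1 h2
      refine ⟨ψ ∘ₗ τ + t • π.smulRight (b k), t * π (b k),
        fun hmem => (hp.mem_or_mem hmem).elim ht hu, fun x => ?_, fun v hv => ?_⟩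
      · simp only [LinearMap.add_apply, LinearMap.comp_apply, LinearMap.smul_apply,
          LinearMap.smulRight_apply]
        exact B.add_mem (hle (h1 _)) (B.smul_mem _ (B.smul_mem _ (hbB k)))
      · simp only [LinearMap.add_apply, LinearMap.comp_apply, LinearMap.smul_apply,
          LinearMap.smulRight_apply]
        rw [h2 _ (Submodule.mem_map_of_mem hv), hτ]
        module

end FreeModules

/-! ### Projectivity at a prime -/

section ProjectiveAt

variable {A : Type u} [CommRing A] {p : Ideal A} {M N : Type*} [AddCommGroup M] [Module A M]
  [AddCommGroup N] [Module A N]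

/-- Up to multiplication by some `s ∉ p`, the module `M` is a direct summand of a finite free
module. For finite modules over a noetherian ring this says that `M_p` is free. -/
def IsProjectiveAt (p : Ideal A) (M : Type*) [AddCommGroup M] [Module A M] : Prop :=
  ∃ (n : ℕ) (f : (Fin n → A) →ₗ[A] M) (g : M →ₗ[A] (Fin n → A)), ∃ s ∉ p, ∀ x, f (g x) = s • x

theorem IsProjectiveAt.of_retract (hp : p.IsPrime) (h : IsProjectiveAt p M) (f : M →ₗ[A] N)
    (g : N →ₗ[A] M) {t : A} (ht : t ∉ p) (hfg : ∀ x, f (g x) = t • x) : IsProjectiveAt p N := by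
  obtain ⟨n, f', g', s, hs, h⟩ := h
  refine ⟨n, f ∘ₗ f', g' ∘ₗ g, s * t, fun hmem => (hp.mem_or_mem hmem).elim hs ht, fun x => ?_⟩
  simp [h, hfg, mul_smul]

theorem IsProjectiveAt.of_equiv (e : M ≃ₗ[A] N) (h : IsProjectiveAt p M) : IsProjectiveAt p N := by
  obtain ⟨n, f', g', s, hs, h⟩ := h
  exact ⟨n, e ∘ₗ f', g' ∘ₗ e.symm, s, hs, fun x => by simp [h]⟩

theorem IsProjectiveAt.of_free (hp : p.IsPrime) [Module.Free A M] [Module.Finite A M] :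
    IsProjectiveAt p M := by
  have : Nontrivial A := ⟨0, 1, fun h => hp.ne_top ((Ideal.eq_top_iff_one p).2 (h ▸ p.zero_mem))⟩
  let e := (Module.finBasis A M).equivFun
  exact ⟨_, e.symm.toLinearMap, e.toLinearMap, 1,
    fun h => hp.ne_top ((Ideal.eq_top_iff_one p).2 h), fun x => by simp⟩

theorem IsProjectiveAt.of_subsingleton (hp : p.IsPrime) [Subsingleton M] : IsProjectiveAt p M :=
  ⟨0, 0, 0, 1, fun h => hp.ne_top ((Ideal.eq_top_iff_one p).2 h), fun _ => Subsingleton.elim _ _⟩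

/-- The quotient by a submodule which is a direct summand at `p` is projective at `p`. -/
theorem IsProjectiveAt.quotient (hp : p.IsPrime) (h : IsProjectiveAt p M) {B : Submodule A M}
    (ψ : M →ₗ[A] M) {t : A} (ht : t ∉ p) (h1 : ∀ x, ψ x ∈ B) (h2 : ∀ v ∈ B, ψ v = t • v) :
    IsProjectiveAt p (M ⧸ B) := by
  refine h.of_retract hp B.mkQ (B.liftQ (t • LinearMap.id - ψ) fun v hv => ?_) ht fun x => ?_
  · simp [h2 v hv]
  · obtain ⟨x, rfl⟩ := Submodule.Quotient.mk_surjective _ x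
    have := (Submodule.Quotient.mk_eq_zero B).2 (h1 x)
    simp [this]

end ProjectiveAt

/-! ### Syzygies in acyclic complexes: Auslander–Buchsbaum and depth -/

section Complexes

variable {A : Type u} [CommRing A]

variable (A) in
/-- `M` is projective at the primes of depth less than `K`, and its depth in each ideal of grade at
least `K` is at least `k`. A `K`-th syzygy of finite projective dimension has this property
for `k = K`. -/
def IsSyzygyLike (K k : ℕ) (M : Type u) [AddCommGroup M] [Module A M] : Prop :=
  (∀ g < K, ∀ p : Ideal A, IsDepthPrime g p → IsProjectiveAt p M) ∧
    ∀ J : Ideal A, DepthGE J K A → DepthGE J k M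

theorem exactAt_succ_iff {F : ChainComplex (ModuleCat.{u} A) ℕ} {n : ℕ} :
    F.ExactAt (n + 1) ↔ Function.Exact (F.d (n + 2) (n + 1)).hom (F.d (n + 1) n).hom := by
  rw [HomologicalComplex.exactAt_iff' F (n + 2) (n + 1) n (by simp) (by simp),
    ShortComplex.ShortExact.moduleCat_exact_iff_function_exact]
  rfl

theorem baseChange_residueField_eq_zero_iff [IsLocalRing A] {M N : Type*} [AddCommGroup M]
    [Module A M] [AddCommGroup N] [Module A N] (f : M →ₗ[A] N) :
    f.baseChange (IsLocalRing.ResidueField A) = 0 ↔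
      ∀ x, f x ∈ IsLocalRing.maximalIdeal A • (⊤ : Submodule A N) := by
  have key : ∀ y : N, y ∈ IsLocalRing.maximalIdeal A • (⊤ : Submodule A N) ↔
      (1 : IsLocalRing.ResidueField A) ⊗ₜ[A] y = 0 := fun y => by
    rw [← LinearMap.ker_tensorProductMk]
    rfl
  constructor
  · intro h x
    rw [key, ← LinearMap.baseChange_tmul, h, LinearMap.zero_apply]
  · intro h
    ext x
    simpa [key] using h x

variable {F : ChainComplex (ModuleCat.{u} A) ℕ}

/-- The cokernel of the differential `F_{j+1} → F_j`. -/
abbrev cokerD (F : ChainComplex (ModuleCat.{u} A) ℕ) (j : ℕ) : Type u :=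
  F.X j ⧸ LinearMap.range (F.d (j + 1) j).hom

theorem d_d_apply (F : ChainComplex (ModuleCat.{u} A) ℕ) (j : ℕ) (x : F.X (j + 2)) :
    (F.d (j + 1) j).hom ((F.d (j + 2) (j + 1)).hom x) = 0 := by
  rw [← LinearMap.comp_apply, ← ModuleCat.hom_comp, F.d_comp_d]
  rfl

/-- The map `coker (F_{j+2} → F_{j+1}) → F_j` induced by the differential. -/
def cokerD.map (F : ChainComplex (ModuleCat.{u} A) ℕ) (j : ℕ) : cokerD F (j + 1) →ₗ[A] F.X j :=
  Submodule.liftQ _ (F.d (j + 1) j).hom (by rintro _ ⟨x, rfl⟩; exact d_d_apply F j x)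

@[simp]
theorem cokerD.map_mk (j : ℕ) (x : F.X (j + 1)) :
    cokerD.map F j (Submodule.Quotient.mk x) = (F.d (j + 1) j).hom x := rfl

theorem cokerD.range_map (j : ℕ) :
    LinearMap.range (cokerD.map F j) = LinearMap.range (F.d (j + 1) j).hom :=
  Submodule.range_liftQ _ _ _

variable [IsLocalRing A] {s : ℕ}

theorem IsMinimalAcyclicFree.exact (hF : IsMinimalAcyclicFree F s) (n : ℕ) :
    Function.Exact (F.d (n + 2) (n + 1)).hom (F.d (n + 1) n).hom :=
  exactAt_succ_iff.1 (hF.acyclic (n + 1) (by omega))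

theorem IsMinimalAcyclicFree.d_mem (hF : IsMinimalAcyclicFree F s) (n : ℕ) (x : F.X (n + 1)) :
    (F.d (n + 1) n).hom x ∈ IsLocalRing.maximalIdeal A • (⊤ : Submodule A (F.X n)) :=
  (baseChange_residueField_eq_zero_iff _).1 (hF.minimal n) x

theorem IsMinimalAcyclicFree.injective_map (hF : IsMinimalAcyclicFree F s) (j : ℕ) :
    Function.Injective (cokerD.map F j) := by
  rw [← LinearMap.ker_eq_bot, cokerD.map, Submodule.ker_liftQ_eq_bot']
  exact (hF.exact j).linearMap_ker_eq.symm

/-- Exactness of `F ⊗ A/(rs)` in degrees above the length of `rs`: each further regular element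
costs one degree. -/
theorem IsMinimalAcyclicFree.exists_sub_mem (hF : IsMinimalAcyclicFree F s) (rs : List A)
    (hrs : IsWeaklyRegular A rs) : ∀ (j : ℕ), rs.length ≤ j → ∀ y : F.X (j + 1),
      (F.d (j + 1) j).hom y ∈ Ideal.ofList rs • (⊤ : Submodule A (F.X j)) →
      ∃ z : F.X (j + 2), y - (F.d (j + 2) (j + 1)).hom z ∈
        Ideal.ofList rs • (⊤ : Submodule A (F.X (j + 1))) := by
  induction rs using List.reverseRecOn with
  | nil =>
    intro j _ y hy
    obtain ⟨z, rfl⟩ := (hF.exact j y).1 (by simpa using hy)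
    exact ⟨z, by simp⟩
  | append_singleton rs x ih =>
    intro j hj y hy
    rw [isWeaklyRegular_append_iff, isWeaklyRegular_singleton_iff] at hrs
    rw [List.length_append, List.length_singleton] at hj
    obtain ⟨j, rfl⟩ : ∃ i, j = i + 1 := ⟨j - 1, by omega⟩
    have := hF.free j
    have hreg : ∀ w : F.X j, x • w ∈ Ideal.ofList rs • (⊤ : Submodule A (F.X j)) →
        w ∈ Ideal.ofList rs • (⊤ : Submodule A (F.X j)) := fun w hw => by
      rw [Module.Free.mem_smul_top_iff] at hw ⊢
      intro π
      have h1 : x • (Submodule.Quotient.mk (π w) :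
          A ⧸ (Ideal.ofList rs • ⊤ : Submodule A A)) = x • 0 := by
        rw [smul_zero, ← Submodule.Quotient.mk_smul, Submodule.Quotient.mk_eq_zero, ← map_smul]
        simpa using hw π
      have h2 := hrs.2 h1
      rw [Submodule.Quotient.mk_eq_zero] at h2
      simpa using h2
    have hsup : ∀ (i : ℕ), Ideal.ofList (rs ++ [x]) • (⊤ : Submodule A (F.X i)) =
        Ideal.ofList rs • (⊤ : Submodule A (F.X i)) ⊔ x • (⊤ : Submodule A (F.X i)) := fun i => by
      rw [Ideal.ofList_append, Submodule.sup_smul, Ideal.ofList_singleton,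
        Submodule.ideal_span_singleton_smul]
    have hmap : ∀ (i : ℕ) (v : F.X (i + 1)),
        v ∈ Ideal.ofList rs • (⊤ : Submodule A (F.X (i + 1))) →
        (F.d (i + 1) i).hom v ∈ Ideal.ofList rs • (⊤ : Submodule A (F.X i)) := fun i v hv =>
      Submodule.smul_top_le_comap_smul_top _ _ hv
    rw [hsup, Submodule.mem_sup] at hy
    obtain ⟨a, ha, _, ⟨w, -, rfl⟩, hy⟩ := hy
    replace hy : a + x • w = (F.d (j + 1 + 1) (j + 1)).hom y := hy
    have h1 : (F.d (j + 1) j).hom w ∈ Ideal.ofList rs • (⊤ : Submodule A (F.X j)) := by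
      apply hreg
      have h2 := congrArg (F.d (j + 1) j).hom hy
      rw [map_add, map_smul, d_d_apply] at h2
      rw [eq_neg_of_add_eq_zero_right h2]
      exact neg_mem (hmap _ _ ha)
    obtain ⟨z, hz⟩ := ih hrs.1 j (by omega) w h1
    obtain ⟨v, hv⟩ := ih hrs.1 (j + 1) (by omega) (y - x • z) (by
      rw [map_sub, map_smul, ← hy, add_sub_assoc, ← smul_sub]
      exact add_mem ha (Submodule.smul_mem _ _ hz))
    refine ⟨v, ?_⟩
    rw [hsup]
    have : y - (F.d (j + 1 + 2) (j + 1 + 1)).hom v =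
        (y - x • z - (F.d (j + 1 + 2) (j + 1 + 1)).hom v) + x • z := by abel
    rw [this]
    exact Submodule.add_mem_sup hv ⟨z, trivial, rfl⟩

/-- If `d w ∈ pF_j`, then `d (y w)` vanishes modulo `rs`, so exactness modulo `rs` puts `y [w]` in
`(rs)` times the cokernel. Coordinates of `[w]` multiplied into `(rs)` by `y` lie in `p`, whence `t
• d w ∈ pB`, as `exists_retraction_at` demands. -/
theorem IsMinimalAcyclicFree.exists_retraction_of_isProjectiveAt (hF : IsMinimalAcyclicFree F s)
    {g j : ℕ} {p : Ideal A} (hp : IsDepthPrime g p) (hj : g ≤ j)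
    (h : IsProjectiveAt p (cokerD F (j + 1))) :
    ∃ ψ : F.X j →ₗ[A] F.X j, ∃ t ∉ p, (∀ x, ψ x ∈ LinearMap.range (F.d (j + 1) j).hom) ∧
      ∀ v ∈ LinearMap.range (F.d (j + 1) j).hom, ψ v = t • v := by
  obtain ⟨hprime, rs, hrs, rfl, y, hy, hpy⟩ := hp
  have := hF.free j
  have := hF.finite (j + 1)
  set B := LinearMap.range (F.d (j + 1) j).hom with hB
  obtain ⟨n, b, hb⟩ : ∃ (n : ℕ) (b : Fin n → F.X j), Submodule.span A (Set.range b) = B :=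
    Submodule.fg_iff_exists_fin_generating_family.1 
      (Module.Finite.iff_fg.1 (Module.Finite.range _))
  obtain ⟨r, α, β, t, ht, hαβ⟩ := h
  rw [← hb]
  refine exists_retraction_at hprime n b ht ?_
  rw [hb]
  rintro _ ⟨w, rfl⟩ hv
  obtain ⟨z, hz⟩ := hF.exists_sub_mem rs hrs j hj (y • w) (by
    rw [map_smul, Module.Free.mem_smul_top_iff]
    intro π
    rw [map_smul, smul_eq_mul, mul_comm]
    exact (hpy _).1 (LinearMap.apply_mem_of_mem_smul_top hv π))
  have h1 : y • (Submodule.Quotient.mk w : cokerD F (j + 1)) ∈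
      Ideal.ofList rs • (⊤ : Submodule A (cokerD F (j + 1))) := by
    have h2 := Submodule.smul_top_le_comap_smul_top (Ideal.ofList rs)
      (LinearMap.range (F.d (j + 2) (j + 1)).hom).mkQ hz
    have h3 : (LinearMap.range (F.d (j + 2) (j + 1)).hom).mkQ
        ((F.d (j + 2) (j + 1)).hom z) = 0 :=
      (Submodule.Quotient.mk_eq_zero _).2 ⟨z, rfl⟩
    rw [Submodule.mem_comap, map_sub, h3, sub_zero, map_smul] at h2
    exact h2
  have h4 : ∀ i, β (Submodule.Quotient.mk w) i ∈ p := fun i => by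
    have := LinearMap.apply_mem_of_mem_smul_top h1 (LinearMap.proj i ∘ₗ β)
    rw [map_smul, smul_eq_mul, mul_comm] at this
    exact (hpy _).2 this
  have h5 : t • (F.d (j + 1) j).hom w =
      (cokerD.map F j) (α (β (Submodule.Quotient.mk w))) := by
    rw [hαβ, map_smul, cokerD.map_mk]
  have h6 : β (Submodule.Quotient.mk w) ∈ p • (⊤ : Submodule A (Fin r → A)) :=
    (Pi.basisFun A (Fin r)).mem_smul_top fun i => by simpa using h4 i
  rw [h5, ← LinearMap.comp_apply]
  have h7 := Submodule.mem_map_of_mem (f := cokerD.map F j ∘ₗ α) h6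
  rw [Submodule.map_smul''] at h7
  refine Submodule.smul_mono le_rfl ?_ h7
  rintro _ ⟨x, -, rfl⟩
  rw [hB, ← cokerD.range_map]
  exact ⟨_, rfl⟩

/-- Descending induction on `j`, starting beyond the length, where the cokernel is zero. -/
theorem IsMinimalAcyclicFree.isProjectiveAt_cokerD (hF : IsMinimalAcyclicFree F s) {g : ℕ}
    {p : Ideal A} (hp : IsDepthPrime g p) (j : ℕ) (hj : g ≤ j) :
    IsProjectiveAt p (cokerD F j) := by
  by_cases hjs : s < j
  · have := hF.length_le j hjs
    exact .of_subsingleton hp.1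
  · obtain ⟨ψ, t, ht, h1, h2⟩ := hF.exists_retraction_of_isProjectiveAt hp hj
      (hF.isProjectiveAt_cokerD hp (j + 1) (by omega))
    have := hF.free j
    have := hF.finite j
    exact IsProjectiveAt.quotient hp.1 (.of_free hp.1) ψ ht h1 h2
termination_by s + 1 - j

theorem IsMinimalAcyclicFree.exists_retraction (hF : IsMinimalAcyclicFree F s)
    {g j : ℕ} {p : Ideal A} (hp : IsDepthPrime g p) (hj : g ≤ j) :
    ∃ ψ : F.X j →ₗ[A] F.X j, ∃ t ∉ p, (∀ x, ψ x ∈ LinearMap.range (F.d (j + 1) j).hom) ∧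
      ∀ v ∈ LinearMap.range (F.d (j + 1) j).hom, ψ v = t • v :=
  hF.exists_retraction_of_isProjectiveAt hp hj (hF.isProjectiveAt_cokerD hp (j + 1) (by omega))

/-- Each cokernel is the kernel of a surjection from a free module onto the preceding one, so every
step gains one unit of depth, as far as `A` permits. -/
theorem IsMinimalAcyclicFree.depthGE_cokerD (hF : IsMinimalAcyclicFree F s) {J : Ideal A}
    (i : ℕ) {l : ℕ} (hl : l ≤ i) (hJ : DepthGE J l A) : DepthGE J l (cokerD F i) := by
  induction i generalizing l with
  | zero => exact fun j hj => absurd hj (by omega)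
  | succ i ih =>
    obtain _ | l := l
    · exact fun j hj => absurd hj (by omega)
    have := hF.free i
    have := hF.finite i
    refine DepthGE.left (A := A) (M := cokerD F (i + 1)) (N := F.X i) (L := cokerD F i)
      (cokerD.map F i) (LinearMap.range (F.d (i + 1) i).hom).mkQ (hF.injective_map i) ?_
      (Submodule.mkQ_surjective _) (.of_free hJ) (ih (by omega) (hJ.mono (by omega)))
    rw [LinearMap.exact_iff, Submodule.ker_mkQ, cokerD.range_map]

end Complexes

/-! ### Embedding a syzygy-like module in a free module -/

section Embedding

variable {A : Type u} [CommRing A] [IsNoetherianRing A] {M : Type u} [AddCommGroup M] [Module A M]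
  {K k : ℕ}

/-- The annihilator of `m` lies in no prime of depth below `K`, so its grade is at least `K`, and
`M` has positive depth in it. -/
theorem eq_zero_of_forall_isDepthPrime
    (hM : ∀ J : Ideal A, DepthGE J K A → DepthGE J (k + 1) M) {m : M}
    (h : ∀ g < K, ∀ p : Ideal A, IsDepthPrime g p → ∃ t ∉ p, t • m = 0) : m = 0 := by
  let J : Ideal A := LinearMap.ker (LinearMap.toSpanSingleton A M m)
  have hJ : (K : ℕ∞) ≤ idealGrade J := by
    by_contra hcon
    obtain ⟨g, hg, p, hp, hle⟩ := exists_isDepthPrime_of_not_le_idealGrade hcon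
    obtain ⟨t, ht, h0⟩ := h g hg p hp
    exact ht (hle (by simpa [J] using h0))
  exact (hM J (depthGE_of_le_idealGrade hJ)).eq_zero fun x hx => by simpa [J] using hx

/-- The coordinates of `f` are the products of generators of `J` with generators of the dual of `M`.
The factors from `J` will make the prolonged complex minimal. At a prime of depth below `K` one of
them is invertible, so `f` splits there. -/
theorem IsSyzygyLike.exists_embedding [Module.Finite A M] (hM : IsSyzygyLike A K (k + 1) M)
    (hk : k ≤ K) {J : Ideal A} (hJ : DepthGE J K A) :
    ∃ (ι : Type) (_ : Fintype ι) (f : M →ₗ[A] (ι → A)), Function.Injective f ∧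
      (∀ x i, f x i ∈ J) ∧ IsSyzygyLike A K k ((ι → A) ⧸ LinearMap.range f) := by
  obtain ⟨a, x, hx⟩ := Submodule.fg_iff_exists_fin_generating_family.1 (IsNoetherian.noetherian J)
  obtain ⟨b, φ, hφ⟩ := Submodule.fg_iff_exists_fin_generating_family.1
    (Module.Finite.fg_top (R := A) (M := M →ₗ[A] A))
  let f : M →ₗ[A] (Fin a × Fin b → A) := LinearMap.pi fun l => x l.1 • φ l.2
  have hf : ∀ m l, f m l = x l.1 * φ l.2 m := fun m l => rfl
  have key : ∀ g < K, ∀ p : Ideal A, IsDepthPrime g p →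
      ∃ (ψ : (Fin a × Fin b → A) →ₗ[A] M), ∃ t ∉ p, ∀ m, ψ (f m) = t • m := fun g hg p hp => by
    obtain ⟨l, hl⟩ : ∃ l, x l ∉ p := by
      by_contra! hcon
      refine hp.not_le hg hJ ?_
      rw [← hx, Ideal.submodule_span_eq, Ideal.span_le]
      rintro _ ⟨l, rfl⟩
      exact hcon l
    obtain ⟨n, α, β, s, hs, hαβ⟩ := hM.1 g hg p hp
    -- The coordinates of `β` are combinations of the `φ j`, so `x l • β` factors through `f`.
    have hc : ∀ i, ∃ c : Fin b → A, ∑ j, c j • φ j = LinearMap.proj i ∘ₗ β := fun i =>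
      (Submodule.mem_span_range_iff_exists_fun A).1 (hφ ▸ trivial)
    choose c hc using hc
    let ψ : (Fin a × Fin b → A) →ₗ[A] (Fin n → A) :=
      LinearMap.pi fun i => ∑ j, c i j • LinearMap.proj (l, j)
    have hψ : ∀ m, ψ (f m) = x l • β m := fun m => by
      ext i
      have h1 := LinearMap.congr_fun (hc i) m
      simp only [LinearMap.sum_apply, LinearMap.smul_apply, smul_eq_mul, LinearMap.comp_apply,
        LinearMap.proj_apply] at h1
      simp only [ψ, LinearMap.pi_apply, LinearMap.sum_apply, LinearMap.smul_apply,
        LinearMap.proj_apply, hf, smul_eq_mul, Pi.smul_apply, ← h1, Finset.mul_sum]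
      exact Finset.sum_congr rfl fun j _ => by ring
    refine ⟨α ∘ₗ ψ, x l * s, fun hmem => (hp.1.mem_or_mem hmem).elim hl hs, fun m => ?_⟩
    rw [LinearMap.comp_apply, hψ, map_smul, hαβ, smul_smul]
  have hinj : Function.Injective f := by
    rw [injective_iff_map_eq_zero]
    refine fun m hm => eq_zero_of_forall_isDepthPrime hM.2 fun g hg p hp => ?_
    obtain ⟨ψ, t, ht, h⟩ := key g hg p hp
    exact ⟨t, ht, by rw [← h, hm, map_zero]⟩
  refine ⟨Fin a × Fin b, inferInstance, f, hinj, fun m l => ?_, fun g hg p hp => ?_,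
    fun J' hJ' => ?_⟩
  · rw [hf]
    exact J.mul_mem_right _ (hx ▸ Submodule.subset_span ⟨_, rfl⟩)
  · obtain ⟨ψ, t, ht, h⟩ := key g hg p hp
    refine IsProjectiveAt.quotient hp.1 (.of_free hp.1) (f ∘ₗ ψ) ht (fun y => ⟨_, rfl⟩) ?_
    rintro _ ⟨m, rfl⟩
    simp [h]
  · exact DepthGE.right f (LinearMap.range f).mkQ hinj
      (by rw [LinearMap.exact_iff, Submodule.ker_mkQ]) (Submodule.mkQ_surjective _)
      (hM.2 J' hJ') (.of_free (hJ'.mono hk))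

end Embedding

/-! ### Prolonging and truncating complexes -/

section Constructions

variable {A : Type u} [CommRing A] [IsLocalRing A] {P : ChainComplex (ModuleCat.{u} A) ℕ} {s : ℕ}

theorem IsMinimalAcyclicFree.mono (hP : IsMinimalAcyclicFree P s) {r : ℕ} (hr : s ≤ r) :
    IsMinimalAcyclicFree P r :=
  { hP with length_le := fun i hi => hP.length_le i (by omega) }

/-- Prolonging a minimal acyclic complex to the right. -/
theorem IsMinimalAcyclicFree.augment (hP : IsMinimalAcyclicFree P s) {G : Type u} [AddCommGroup G]
    [Module A G] [Module.Free A G] [Module.Finite A G] (f : P.X 0 →ₗ[A] G)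
    (hf : Function.Exact (P.d 1 0).hom f)
    (hm : ∀ x, f x ∈ IsLocalRing.maximalIdeal A • (⊤ : Submodule A G)) :
    IsMinimalAcyclicFree (ChainComplex.augment P (X := ModuleCat.of A G) (ModuleCat.ofHom f)
      (ModuleCat.hom_ext hf.linearMap_comp_eq_zero)) (s + 1) where
  free := fun
    | 0 => ‹Module.Free A G›
    | i + 1 => hP.free i
  finite := fun
    | 0 => ‹Module.Finite A G›
    | i + 1 => hP.finite i
  length_le := fun
    | 0, h => absurd h (by omega)
    | i + 1, h => hP.length_le i (by omega)
  acyclic := fun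
    | 0, h => absurd h (by omega)
    | 1, _ => exactAt_succ_iff.2 hf
    | i + 2, _ => exactAt_succ_iff.2 (hP.exact i)
  minimal := fun
    | 0 => (baseChange_residueField_eq_zero_iff _).2 hm
    | i + 1 => hP.minimal i

/-- The part `⋯ → F_{i+1} → F_i` of a complex, with `F_i` placed in degree `0`. -/
def truncateBelow (F : ChainComplex (ModuleCat.{u} A) ℕ) (i : ℕ) :
    ChainComplex (ModuleCat.{u} A) ℕ where
  X j := F.X (i + j)
  d j k := F.d (i + j) (i + k)
  shape j k h := F.shape _ _ fun h' => h (by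
    simp only [ComplexShape.down_Rel] at h' ⊢
    omega)
  d_comp_d' _ _ _ _ _ := F.d_comp_d _ _ _

theorem IsMinimalAcyclicFree.truncateBelow (hP : IsMinimalAcyclicFree P s) (i : ℕ) :
    IsMinimalAcyclicFree (truncateBelow P i) s where
  free j := hP.free (i + j)
  finite j := hP.finite (i + j)
  length_le j hj := hP.length_le (i + j) (by omega)
  acyclic := fun
    | 0, h => absurd h (by omega)
    | j + 1, _ => exactAt_succ_iff.2 (hP.exact (i + j))
  minimal j := hP.minimal (i + j)

end Constructions

/-! ### Order ideals over a stiff ring -/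

section OrderIdeal

variable {A : Type u} [CommRing A] [IsLocalRing A] [IsNoetherianRing A]

theorem IsSyzygyLike.exists_augment {P : ChainComplex (ModuleCat.{u} A) ℕ} {s K k : ℕ}
    (hP : IsMinimalAcyclicFree P s) (h : IsSyzygyLike A K (k + 1) (cokerD P 0)) (hk : k ≤ K)
    {J : Ideal A} (hJ : DepthGE J K A) (hJm : J ≤ IsLocalRing.maximalIdeal A) :
    ∃ (ι : Type) (_ : Fintype ι) (f : cokerD P 0 →ₗ[A] (ι → A)),
      ∃ hf : Function.Exact (P.d 1 0).hom (f ∘ₗ (LinearMap.range (P.d 1 0).hom).mkQ),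
      IsMinimalAcyclicFree (ChainComplex.augment P (X := ModuleCat.of A (ι → A))
        (ModuleCat.ofHom (f ∘ₗ (LinearMap.range (P.d 1 0).hom).mkQ))
        (ModuleCat.hom_ext hf.linearMap_comp_eq_zero)) (s + 1) ∧
      IsSyzygyLike A K k ((ι → A) ⧸
        LinearMap.range (f ∘ₗ (LinearMap.range (P.d 1 0).hom).mkQ)) := by
  have := hP.finite 0
  obtain ⟨ι, _, f, hinj, hfJ, hcoker⟩ := h.exists_embedding hk hJ
  have hf : Function.Exact (P.d 1 0).hom (f ∘ₗ (LinearMap.range (P.d 1 0).hom).mkQ) := by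
    rw [LinearMap.exact_iff, LinearMap.ker_comp_of_ker_eq_bot _ (LinearMap.ker_eq_bot.2 hinj),
      Submodule.ker_mkQ]
  refine ⟨ι, ‹_›, f, hf, hP.augment _ hf fun x => ?_, ?_⟩
  · exact (Pi.basisFun A ι).mem_smul_top fun i => by simpa using hJm (hfJ _ i)
  · rwa [LinearMap.range_comp_of_range_eq_top _ (Submodule.range_mkQ _)]

/-- Each prolongation moves the column up one degree and uses one unit of `k`; at `k = 0` stiffness
applies. -/
theorem IsStiffRing.le_idealGrade_columnIdeal (hA : IsStiffRing A) {K k : ℕ} (hk : k ≤ K)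
    {J : Ideal A} (hJ : DepthGE J K A) (hJm : J ≤ IsLocalRing.maximalIdeal A) :
    ∀ {P : ChainComplex (ModuleCat.{u} A) ℕ} {s : ℕ}, IsMinimalAcyclicFree P s →
      IsSyzygyLike A K k (cokerD P 0) → ∀ (j m n : ℕ) (b : Module.Basis (Fin m) A (P.X (j + 1)))
      (b' : Module.Basis (Fin n) A (P.X j)) (c : Fin m),
      ((j + 1 + k : ℕ) : ℕ∞) ≤
        idealGrade (columnIdeal (LinearMap.toMatrix b b' (P.d (j + 1) j).hom) c) := by
  induction k with
  | zero =>
    intro P s hP _ j m n b b' c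
    -- The degree `j + 1` may exceed `s`, so the length bound is enlarged.
    exact hA (max s (j + 1)) P (hP.mono (le_max_left _ _)) (j + 1) (by omega)
      (le_max_right _ _) m n b b' c
  | succ k ih =>
    intro P s hP h j m n b b' c
    obtain ⟨ι, _, f, hf, hP', h'⟩ := h.exists_augment hP (by omega) hJ hJm
    rw [show j + 1 + (k + 1) = j + 1 + 1 + k by omega]
    exact ih (by omega) hP' h' (j + 1) m n b b' c

/-- In a syzygy over a stiff ring the order ideals of minimal generators have large grade. -/
theorem IsStiffRing.exists_form_notMem (hA : IsStiffRing A) {K k : ℕ} (hk : k ≤ K)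
    {J : Ideal A} (hJ : DepthGE J K A) (hJm : J ≤ IsLocalRing.maximalIdeal A)
    {P : ChainComplex (ModuleCat.{u} A) ℕ} {s : ℕ} (hP : IsMinimalAcyclicFree P s)
    (h : IsSyzygyLike A K k (cokerD P 0)) {ι : Type*} [Finite ι] (b : Module.Basis ι A (P.X 0))
    (c : ι) {g : ℕ} (hg : g < k) {p : Ideal A} (hp : IsDepthPrime g p) :
    ∃ φ : cokerD P 0 →ₗ[A] A, φ (Submodule.Quotient.mk (b c)) ∉ p := by
  obtain ⟨k, rfl⟩ : ∃ l, k = l + 1 := ⟨k - 1, by omega⟩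
  obtain ⟨κ, _, f, hf, hP', h'⟩ := h.exists_augment hP (by omega) hJ hJm
  have := Fintype.ofFinite ι
  let e := Fintype.equivFin ι
  let b' : Module.Basis (Fin (Fintype.card κ)) A (κ → A) :=
    (Pi.basisFun A κ).reindex (Fintype.equivFin κ)
  -- The new differential, in degree 1, has as entries of this column values of forms at the class
  -- of `b c`; `k` more prolongations remain.
  have hgrade := hA.le_idealGrade_columnIdeal (by omega) hJ hJm hP' h' 0 _ _ (b.reindex e) b' (e c)
  have hnot := hp.not_le (k := 0 + 1 + k) (by omega) (depthGE_of_le_idealGrade hgrade)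
  by_contra! hcon
  apply hnot
  rw [columnIdeal, Ideal.span_le]
  rintro _ ⟨r, rfl⟩
  change LinearMap.toMatrix (b.reindex e) b' (f ∘ₗ (LinearMap.range (P.d 1 0).hom).mkQ) r (e c) ∈ p
  rw [LinearMap.toMatrix_apply, Module.Basis.reindex_apply, Equiv.symm_apply_apply]
  exact hcon (b'.coord r ∘ₗ f)

end OrderIdeal

/-! ### Partial bases at a prime -/

section DualFamily

variable {A : Type u} [CommRing A] {Z : Type u} [AddCommGroup Z] [Module A Z] {ι : Type}

variable (A) in
/-- The linear combinations of the vectors `v j`, `j ∈ S`. -/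
noncomputable def combination (v : ι → Z) (S : Finset ι) : (S → A) →ₗ[A] Z :=
  Fintype.linearCombination A fun j : S => v j

theorem combination_apply (v : ι → Z) (S : Finset ι) (r : S → A) :
    combination A v S r = ∑ j : S, r j • v j := rfl

theorem mkQ_combination {F : Type u} [AddCommGroup F] [Module A F] (b : ι → F) (S : Finset ι) (N : Submodule A F) (r : S → A) :
    (Submodule.Quotient.mk (combination A b S r) : F ⧸ N) =
      combination A (fun j => (Submodule.Quotient.mk (b j) : F ⧸ N)) S r := by
  rw [← Submodule.mkQ_apply, combination_apply, map_sum]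
  rfl

theorem depthGE_of_exact_combination {J : Ideal A} {k : ℕ} {v : ι → Z} {S : Finset ι}
    (hinj : Function.Injective (combination A v S)) {Q : Type u} [AddCommGroup Q]
    [Module A Q] (ρ : Z →ₗ[A] Q) (hρ : Function.Surjective ρ)
    (hex : Function.Exact (combination A v S) ρ) (hZ : DepthGE J k Z)
    (hJ : S.Nonempty → DepthGE J (k + 1) A) : DepthGE J k Q := by
  refine DepthGE.right (combination A v S) ρ hinj hex hρ ?_ hZ
  obtain rfl | hS := S.eq_empty_or_nonempty
  · exact .of_subsingleton
  · exact .of_free (hJ hS)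

variable [DecidableEq ι]

/-- Up to some `t ∉ p`, the vectors `v j`, `j ∈ S`, admit a dual family of linear forms; that is,
they are a basis of a free direct summand of `Z_p`. -/
def HasDualFamilyAt (p : Ideal A) (v : ι → Z) (S : Finset ι) : Prop :=
  ∃ (θ : ι → Z →ₗ[A] A), ∃ t ∉ p, ∀ j ∈ S, ∀ l ∈ S, θ j (v l) = if j = l then t else 0

theorem HasDualFamilyAt.empty {p : Ideal A} (hp : p.IsPrime) (v : ι → Z) :
    HasDualFamilyAt p v ∅ :=
  ⟨0, 1, fun h => hp.ne_top ((Ideal.eq_top_iff_one p).2 h), by simp⟩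

/-- Elimination without division: multiples of `φ` correct the old forms so that they vanish at `v
e`. -/
theorem HasDualFamilyAt.insert {p : Ideal A} (hp : p.IsPrime) {v : ι → Z} {S : Finset ι}
    (h : HasDualFamilyAt p v S) {e : ι} (he : e ∉ S) (φ : Z →ₗ[A] A) (hφ : ∀ j ∈ S, φ (v j) = 0)
    (hφe : φ (v e) ∉ p) : HasDualFamilyAt p v (insert e S) := by
  obtain ⟨θ, t, ht, hθ⟩ := h
  refine ⟨fun j => if j = e then t • φ else φ (v e) • θ j - θ j (v e) • φ, t * φ (v e),
    fun hmem => (hp.mem_or_mem hmem).elim ht hφe, ?_⟩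
  intro j hj l hl
  rw [Finset.mem_insert] at hj hl
  by_cases hje : j = e <;> by_cases hle : l = e
  · subst hje hle
    simp
  · subst hje
    have hl := hl.resolve_left hle
    simp [hφ l hl, Ne.symm hle]
  · subst hle
    simp [hje, mul_comm]
  · have hj := hj.resolve_left hje
    have hl := hl.resolve_left hle
    simp only [hje, if_false, LinearMap.sub_apply, LinearMap.smul_apply, smul_eq_mul, hθ j hj l hl,
      hφ l hl, mul_zero, sub_zero]
    split_ifs <;> ring

theorem HasDualFamilyAt.apply_combination {v : ι → Z} {S : Finset ι} {θ : ι → Z →ₗ[A] A} {t : A}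
    (hθ : ∀ j ∈ S, ∀ l ∈ S, θ j (v l) = if j = l then t else 0) (r : S → A) (j : S) :
    θ j (combination A v S r) = t * r j := by
  rw [combination_apply, map_sum, Finset.sum_eq_single j]
  · rw [map_smul, hθ j j.2 j j.2, if_pos rfl, smul_eq_mul, mul_comm]
  · intro l _ hl
    rw [map_smul, hθ j j.2 l l.2, if_neg (fun h => hl (Subtype.ext h.symm)), smul_zero]
  · simp

theorem injective_combination [IsNoetherianRing A] {v : ι → Z} {S : Finset ι}
    (h : ∀ p : Ideal A, IsDepthPrime 0 p → HasDualFamilyAt p v S) :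
    Function.Injective (combination A v S) := by
  rw [injective_iff_map_eq_zero]
  intro r hr
  funext j
  refine eq_zero_of_forall_isDepthPrime (A := A) (M := A) (K := 1) (k := 0) (fun _ h => h) ?_
  intro g hg p hp
  obtain rfl : g = 0 := by omega
  obtain ⟨θ, t, ht, hθ⟩ := h p hp
  refine ⟨t, ht, ?_⟩
  rw [smul_eq_mul, ← HasDualFamilyAt.apply_combination hθ r j, hr, map_zero]

theorem HasDualFamilyAt.isProjectiveAt {p : Ideal A} (hp : p.IsPrime) {v : ι → Z} {S : Finset ι}
    (h : HasDualFamilyAt p v S) (hZ : IsProjectiveAt p Z) {Q : Type u} [AddCommGroup Q]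
    [Module A Q] (ρ : Z →ₗ[A] Q) (hρ : Function.Surjective ρ)
    (hex : Function.Exact (combination A v S) ρ) : IsProjectiveAt p Q := by
  obtain ⟨θ, t, ht, hθ⟩ := h
  refine IsProjectiveAt.of_equiv (ρ.quotKerEquivOfSurjective hρ) ?_
  rw [hex.linearMap_ker_eq]
  refine hZ.quotient hp (combination A v S ∘ₗ LinearMap.pi fun j : S => θ j) ht
    (fun x => ⟨_, rfl⟩) ?_
  rintro _ ⟨r, rfl⟩
  rw [LinearMap.comp_apply, ← map_smul]
  congr 1
  funext j
  simpa using HasDualFamilyAt.apply_combination hθ r j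

end DualFamily

/-! ### Deleting basis vectors from the resolution -/

section Quotient

variable {A : Type u} [CommRing A] {F G : Type u} [AddCommGroup F] [Module A F] [AddCommGroup G]
  [Module A G] {ι : Type}

/-- The coordinates of a vector outside `S`. -/
noncomputable def Module.Basis.coordsOutside (b : Module.Basis ι A F) (S : Finset ι) :
    F →ₗ[A] ({j // j ∉ S} → A) :=
  LinearMap.pi fun j => b.coord j

theorem Module.Basis.coordsOutside_of_mem (b : Module.Basis ι A F) {S : Finset ι} {j : ι}
    (hj : j ∈ S) : b.coordsOutside S (b j) = 0 := by
  funext l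
  simp only [coordsOutside, LinearMap.pi_apply, Module.Basis.coord_apply, Module.Basis.repr_self,
    Pi.zero_apply]
  exact Finsupp.single_eq_of_ne fun h => l.2 (h ▸ hj)

/-- The map from the cokernel of `d : G → F` to its quotient by the classes of `b j`, `j ∈ S`. -/
noncomputable def Module.Basis.cokerMap (b : Module.Basis ι A F) (S : Finset ι) (d : G →ₗ[A] F) :
    (F ⧸ LinearMap.range d) →ₗ[A]
      (({j // j ∉ S} → A) ⧸ LinearMap.range (b.coordsOutside S ∘ₗ d)) :=
  Submodule.mapQ _ _ (b.coordsOutside S) (by rintro _ ⟨x, rfl⟩; exact ⟨x, rfl⟩)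

theorem Module.Basis.cokerMap_mk (b : Module.Basis ι A F) (S : Finset ι) (d : G →ₗ[A] F) (x : F) :
    b.cokerMap S d (Submodule.Quotient.mk x) = Submodule.Quotient.mk (b.coordsOutside S x) := rfl

variable [Fintype ι]

theorem Module.Basis.coordsOutside_eq_zero_iff (b : Module.Basis ι A F) (S : Finset ι) (x : F) :
    b.coordsOutside S x = 0 ↔ ∃ r : S → A, combination A b S r = x := by
  constructor
  · intro hx
    refine ⟨fun j => b.repr x j, ?_⟩
    conv_rhs => rw [← b.sum_repr x]
    rw [combination_apply, ← Finset.sum_subset (Finset.subset_univ S), ← Finset.sum_coe_sort S]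
    intro j _ hj
    have := congrFun hx ⟨j, hj⟩
    simp only [coordsOutside, LinearMap.pi_apply, Module.Basis.coord_apply, Pi.zero_apply] at this
    rw [this, zero_smul]
  · rintro ⟨r, rfl⟩
    rw [combination_apply, map_sum]
    exact Finset.sum_eq_zero fun j _ => by rw [map_smul, b.coordsOutside_of_mem j.2, smul_zero]

theorem Module.Basis.exact_cokerMap (b : Module.Basis ι A F) (S : Finset ι) (d : G →ₗ[A] F) :
    Function.Exact (combination A
      (fun j => (Submodule.Quotient.mk (b j) : F ⧸ LinearMap.range d)) S) (b.cokerMap S d) := by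
  intro x
  obtain ⟨x, rfl⟩ := Submodule.Quotient.mk_surjective _ x
  rw [b.cokerMap_mk, Submodule.Quotient.mk_eq_zero]
  constructor
  · rintro ⟨y, hy⟩
    obtain ⟨r, hr⟩ := (b.coordsOutside_eq_zero_iff S (x - d y)).1 (by
      rw [map_sub, ← hy, LinearMap.comp_apply, sub_self])
    refine ⟨r, ?_⟩
    rw [← mkQ_combination, hr, Submodule.Quotient.eq]
    exact ⟨-y, by simp⟩
  · rintro ⟨r, hr⟩
    rw [← mkQ_combination, Submodule.Quotient.eq] at hr
    obtain ⟨y, hy⟩ := hr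
    refine ⟨-y, ?_⟩
    have h0 := (b.coordsOutside_eq_zero_iff S (combination A b S r)).2 ⟨r, rfl⟩
    rw [LinearMap.comp_apply, map_neg, map_neg, hy, map_sub, h0]
    simp

theorem Module.Basis.coordsOutside_comp_eq_zero_iff (b : Module.Basis ι A F) {S : Finset ι}
    {d : G →ₗ[A] F} (hinj : Function.Injective (combination A
      (fun j => (Submodule.Quotient.mk (b j) : F ⧸ LinearMap.range d)) S)) (x : G) :
    b.coordsOutside S (d x) = 0 ↔ d x = 0 := by
  refine ⟨fun h => ?_, fun h => by rw [h, map_zero]⟩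
  obtain ⟨r, hr⟩ := (b.coordsOutside_eq_zero_iff S _).1 h
  have h0 : combination A
      (fun j => (Submodule.Quotient.mk (b j) : F ⧸ LinearMap.range d)) S r = 0 := by
    rw [← mkQ_combination, hr, Submodule.Quotient.mk_eq_zero]
    exact ⟨x, rfl⟩
  rw [← hr, hinj (h0.trans (map_zero _).symm), map_zero]

variable [DecidableEq ι]

theorem Module.Basis.coordsOutside_self (b : Module.Basis ι A F) (S : Finset ι)
    (e : {j // j ∉ S}) : b.coordsOutside S (b e) = Pi.basisFun A _ e := by
  funext j
  simp only [coordsOutside, LinearMap.pi_apply, Module.Basis.coord_apply, Module.Basis.repr_self,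
    Pi.basisFun_apply, Pi.single_apply, Finsupp.single_apply, Subtype.ext_iff, eq_comm]

theorem Module.Basis.surjective_coordsOutside (b : Module.Basis ι A F) (S : Finset ι) :
    Function.Surjective (b.coordsOutside S) := by
  rw [← LinearMap.range_eq_top, eq_top_iff, ← (Pi.basisFun A {j // j ∉ S}).span_eq,
    Submodule.span_le]
  rintro _ ⟨e, rfl⟩
  exact ⟨_, b.coordsOutside_self S e⟩

theorem Module.Basis.surjective_cokerMap (b : Module.Basis ι A F) (S : Finset ι)
    (d : G →ₗ[A] F) : Function.Surjective (b.cokerMap S d) := by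
  intro y
  obtain ⟨y, rfl⟩ := Submodule.Quotient.mk_surjective _ y
  obtain ⟨x, rfl⟩ := b.surjective_coordsOutside S y
  exact ⟨Submodule.Quotient.mk x, rfl⟩

/-- Injectivity says that the span of the deleted basis vectors meets the image of the differential
trivially, so deleting them does not enlarge the kernel. -/
theorem IsMinimalAcyclicFree.augment_coordsOutside [IsLocalRing A]
    {P : ChainComplex (ModuleCat.{u} A) ℕ} {s : ℕ} (hP : IsMinimalAcyclicFree P s)
    (b : Module.Basis ι A (P.X 0)) {S : Finset ι}
    (hinj : Function.Injective (combination A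
      (fun j => (Submodule.Quotient.mk (b j) : cokerD P 0)) S)) :
    ∃ P' : ChainComplex (ModuleCat.{u} A) ℕ, IsMinimalAcyclicFree P' (s + 1) ∧
      ∃ b' : Module.Basis {j // j ∉ S} A (P'.X 0), ∃ ρ : cokerD P 0 →ₗ[A] cokerD P' 0,
        Function.Surjective ρ ∧
        Function.Exact (combination A
          (fun j => (Submodule.Quotient.mk (b j) : cokerD P 0)) S) ρ ∧
        ∀ e, ρ (Submodule.Quotient.mk (b e.1)) = Submodule.Quotient.mk (b' e) := by
  have hex : Function.Exact ((_root_.truncateBelow P 1).d 1 0).hom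
      (b.coordsOutside S ∘ₗ (P.d 1 0).hom) := fun x => by
    exact (b.coordsOutside_comp_eq_zero_iff hinj x).trans (hP.exact 0 x)
  refine ⟨_, (hP.truncateBelow 1).augment (b.coordsOutside S ∘ₗ (P.d 1 0).hom) hex fun x => ?_,
    Pi.basisFun A _, b.cokerMap S (P.d 1 0).hom, b.surjective_cokerMap S _, b.exact_cokerMap S _,
    fun e => ?_⟩
  · exact Submodule.smul_top_le_comap_smul_top _ (b.coordsOutside S) (hP.d_mem 0 x)
  · exact congrArg Submodule.Quotient.mk (b.coordsOutside_self S e)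

end Quotient

/-! ### Dual families and the bound on minors -/

section Main

variable {A : Type u} [CommRing A] [IsLocalRing A] [IsNoetherianRing A]

theorem IsStiffRing.hasDualFamilyAt (hA : IsStiffRing A) {i : ℕ} {J : Ideal A}
    (hJ : DepthGE J i A) (hJm : J ≤ IsLocalRing.maximalIdeal A)
    {P : ChainComplex (ModuleCat.{u} A) ℕ} {s : ℕ} (hP : IsMinimalAcyclicFree P s)
    (hproj : ∀ g ≤ i, ∀ p : Ideal A, IsDepthPrime g p → IsProjectiveAt p (cokerD P 0))
    (hdepth : ∀ l ≤ i, ∀ I : Ideal A, DepthGE I l A → DepthGE I l (cokerD P 0))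
    {ι : Type} [Fintype ι] [DecidableEq ι] (b : Module.Basis ι A (P.X 0)) (S : Finset ι) :
    ∀ g, g + S.card ≤ i → ∀ p : Ideal A, IsDepthPrime g p →
      HasDualFamilyAt p (fun j => (Submodule.Quotient.mk (b j) : cokerD P 0)) S := by
  induction S using Finset.induction_on with
  | empty => exact fun g _ p hp => .empty hp.1 _
  | insert e S he ih =>
    intro g hg p hp
    rw [Finset.card_insert_of_notMem he] at hg
    have hinj := injective_combination fun p hp => ih 0 (by omega) p hp
    obtain ⟨P', hP', b', ρ, hρ, hex, hρb⟩ := hP.augment_coordsOutside b hinj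
    -- For nonempty `S`, depth `i - |S|` of the quotient requires one more unit of depth of `A`. For
    -- empty `S` nothing is divided out, and the minimum keeps the bound within the depth `i` of
    -- `J`.
    have hsyz : IsSyzygyLike A (min i (i - S.card + 1)) (i - S.card) (cokerD P' 0) := by
      refine ⟨fun g hg p hp => ?_, fun I hI => ?_⟩
      · exact (ih g (by omega) p hp).isProjectiveAt hp.1 (hproj g (by omega) p hp) ρ hρ hex
      · refine depthGE_of_exact_combination hinj ρ hρ hex
          (hdepth _ (by omega) I (hI.mono (by omega))) fun hS => hI.mono ?_
        have := hS.card_pos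
        omega
    obtain ⟨φ, hφ⟩ := hA.exists_form_notMem (by omega) (hJ.mono (by omega)) hJm hP' hsyz b'
      ⟨e, he⟩ (g := g) (by omega) hp
    refine (ih g (by omega) p hp).insert hp.1 he (φ ∘ₗ ρ) (fun j hj => ?_) ?_
    · have h0 : ρ (combination A (fun j => (Submodule.Quotient.mk (b j) : cokerD P 0)) S
          (Pi.single ⟨j, hj⟩ 1)) = 0 := hex.apply_apply_eq_zero _
      rw [combination, Fintype.linearCombination_apply_single, one_smul] at h0
      rw [LinearMap.comp_apply, h0, map_zero]
    · rw [LinearMap.comp_apply, hρb ⟨e, he⟩]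
      exact hφ

/-- The rows of `Y * W` are combinations of rows of `W`. Multilinearity expands the determinant, and
choices with a repeated row contribute zero. -/
theorem Matrix.det_mul_mem_span_minors {R : Type*} [CommRing R] {n t : ℕ}
    (Y : Matrix (Fin t) (Fin n) R) (W : Matrix (Fin n) (Fin t) R) :
    (Y * W).det ∈ Ideal.span (Set.range fun r : Fin t ↪ Fin n => (W.submatrix r id).det) := by
  have h : (Y * W).det =
      ∑ f : Fin t → Fin n, (∏ k, Y k (f k)) • (W.submatrix f id).det := by
    have h1 : (Y * W : Matrix (Fin t) (Fin t) R) = fun k => ∑ r, Y k r • W r := by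
      ext k l
      simp [Matrix.mul_apply]
    rw [h1]
    change Matrix.detRowAlternating.toMultilinearMap (fun k => ∑ r, Y k r • W r) = _
    rw [MultilinearMap.map_sum]
    refine Finset.sum_congr rfl fun f _ => ?_
    rw [MultilinearMap.map_smul_univ]
    rfl
  rw [h]
  refine Ideal.sum_mem _ fun f _ => ?_
  rw [smul_eq_mul]
  by_cases hf : Function.Injective f
  · exact Ideal.mul_mem_left _ _ (Ideal.subset_span ⟨⟨f, hf⟩, rfl⟩)
  · rw [Function.not_injective_iff] at hf
    obtain ⟨k, l, hkl, hne⟩ := hf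
    rw [Matrix.det_zero_of_row_eq hne (by ext; simp [hkl]), mul_zero]
    exact zero_mem _

theorem IsStiffRing.le_idealGrade_columnMinorIdeal
    (hA : IsStiffRing A) {s : ℕ} {F : ChainComplex (ModuleCat.{u} A) ℕ}
    (hF : IsMinimalAcyclicFree F s) {i t : ℕ} (ht : 1 ≤ t) (hti : t ≤ i + 1) (his : i + 1 ≤ s)
    {m n : ℕ} (b : Module.Basis (Fin m) A (F.X (i + 1))) (b' : Module.Basis (Fin n) A (F.X i))
    (c : Fin t ↪ Fin m) :
    ((i + 1 - t + 1 : ℕ) : ℕ∞) ≤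
      idealGrade (columnMinorIdeal (LinearMap.toMatrix b b' (F.d (i + 1) i).hom) c) := by
  set X := LinearMap.toMatrix b b' (F.d (i + 1) i).hom with hX
  by_contra hcon
  obtain ⟨g, hg, p, hp, hle⟩ := exists_isDepthPrime_of_not_le_idealGrade hcon
  -- Any proper ideal of large enough grade would serve as `J`; as `t ≥ 1`, a column ideal is at
  -- hand.
  have hJ : DepthGE (columnIdeal X (c ⟨0, ht⟩)) (i + 1) A :=
    depthGE_of_le_idealGrade (hA s F hF (i + 1) (by omega) his m n b b' (c ⟨0, ht⟩))
  have hJm : columnIdeal X (c ⟨0, ht⟩) ≤ IsLocalRing.maximalIdeal A := by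
    rw [columnIdeal, Ideal.span_le]
    rintro _ ⟨r, rfl⟩
    simp only [hX, LinearMap.toMatrix_apply]
    exact LinearMap.apply_mem_of_mem_smul_top (hF.d_mem i _) (b'.coord r)
  obtain ⟨θ, u, hu, hθ⟩ : HasDualFamilyAt p
      (fun j => (Submodule.Quotient.mk (b j) : cokerD F (i + 1))) (Finset.univ.map c) := hA.hasDualFamilyAt hJ hJm (hF.truncateBelow (i + 1))
    (fun g hg p hp => hF.isProjectiveAt_cokerD hp (i + 1) hg)
    (fun l hl I hI => hF.depthGE_cokerD (i + 1) hl hI) (ι := Fin m) b (Finset.univ.map c) g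
    (by rw [Finset.card_map, Finset.card_univ, Fintype.card_fin]; omega) p hp
  -- Since `t ≥ 1`, `g ≤ i`, so the image of the differential is a summand at `p`. This yields `ψ'`,
  -- a left inverse up to `w`.
  obtain ⟨ψ, w, hw, h1, h2⟩ := hF.exists_retraction (j := i) hp (by omega)
  let ε := LinearEquiv.ofInjective (cokerD.map F i) (hF.injective_map i)
  let ψ' : F.X i →ₗ[A] cokerD F (i + 1) := ε.symm.toLinearMap ∘ₗ
    ψ.codRestrict (LinearMap.range (cokerD.map F i)) fun x => by rw [cokerD.range_map]; exact h1 x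
  have hψ' : ∀ x : F.X (i + 1), ψ' ((F.d (i + 1) i).hom x) = w • Submodule.Quotient.mk x :=
    fun x => by
      apply ε.injective
      rw [LinearMap.comp_apply, LinearEquiv.coe_coe, LinearEquiv.apply_symm_apply]
      ext
      rw [LinearMap.codRestrict_apply, h2 _ ⟨x, rfl⟩]
      simp [ε]
  let Y : Matrix (Fin t) (Fin n) A := fun k r => θ (c k) (ψ' (b' r))
  have hYX : Y * X.submatrix id c = (w * u) • (1 : Matrix (Fin t) (Fin t) A) := by
    ext k l
    have hsum : ∑ r, X r (c l) • b' r = (F.d (i + 1) i).hom (b (c l)) := by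
      simp only [hX, LinearMap.toMatrix_apply]
      exact b'.sum_repr _
    have h3 : θ (c k) (ψ' ((F.d (i + 1) i).hom (b (c l)))) = w * if k = l then u else 0 := by
      rw [hψ', map_smul, smul_eq_mul]
      have := hθ (c k) (by simp) (c l) (by simp)
      simp only [c.injective.eq_iff] at this
      rw [← this]
    rw [← hsum, map_sum, map_sum] at h3
    rw [Matrix.mul_apply]
    simp only [map_smul, smul_eq_mul] at h3
    simp only [Matrix.submatrix_apply, id, Y, Matrix.smul_apply, Matrix.one_apply, smul_eq_mul]
    calc _ = ∑ r, X r (c l) * θ (c k) (ψ' (b' r)) :=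
          Finset.sum_congr rfl fun r _ => mul_comm _ _
      _ = _ := h3
      _ = _ := by split_ifs <;> simp
  have hdet := hle (Matrix.det_mul_mem_span_minors Y (X.submatrix id c))
  rw [hYX, Matrix.det_smul, Matrix.det_one, mul_one] at hdet
  exact (hp.1.mem_or_mem (hp.1.mem_of_pow_mem _ hdet)).elim hw hu

end Main

theorem theorem14 {A : Type u} [CommRing A] [IsLocalRing A] [IsNoetherianRing A]
    (hA : IsStiffRing A) (s : ℕ) (F : ChainComplex (ModuleCat.{u} A) ℕ)
    (hF : IsMinimalAcyclicFree F s) (i t : ℕ) (ht : 1 ≤ t) (hti : t ≤ i) (his : i < s)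
    (m n : ℕ) (b : Module.Basis (Fin m) A (F.X i)) (b' : Module.Basis (Fin n) A (F.X (i - 1)))
    (c : Fin t ↪ Fin m) :
    ((i - t + 1 : ℕ) : ℕ∞) ≤
      idealGrade (columnMinorIdeal (LinearMap.toMatrix b b' (F.d i (i - 1)).hom) c) := by
  obtain ⟨i, rfl⟩ : ∃ j, i = j + 1 := ⟨i - 1, by omega⟩
  exact hA.le_idealGrade_columnMinorIdeal hF ht hti his.le b b' c
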